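/- For a polynomial $F\in\mathbb R[x]$ let $L(F)$ denote the sum of the absolute values of its coefficients. For an algebraic number $b$ let $P\in\mathbb Z[x]$ be its minimal polynomial over $\mathbb Z$ (irreducible in $\mathbb Z[x]$, with positive leading coefficient and $P(b)=0$), and let the reduced length of $b$ be $$\ell(b)=\inf_{G\in\Gamma}L(PG),$$ where $\Gamma$ is the set of all $G\in\mathbb R[x]$ whose constant coefficient or leading coefficient equals $1$. A set $S\subseteq\mathbb R$ is called $(1-\epsilon)$-large if it is Lebesgue measurable and $|S\cap I|\ge 1-\epsilon$ for every interval $I\subset\mathbb R$ of length $1$, where $|\cdot|$ is Lebesgue measure. **Theorem.** Let $b>1$ be a real algebraic number. For every $\epsilon\in(1-1/\ell(b),1]$ there exists a $(1-\epsilon)$-large set $S\subset\mathbb R$ that contains no affine copy of $\{b^n\}$; that is, there are no $x\in\mathbb R\setminus\{0\}$ and $t\in\mathbb R$ such that $xb^n+t\in S$ for all integers $n\ge 0$. -/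

import Mathlib

open Polynomial

noncomputable section

/-- `S` is `c`-large: Lebesgue measurable, and `|S ∩ I| ≥ c` for every interval `I` of unit
length. (Taking `I` closed loses nothing, as end points are null.) -/
def IsLargeSet (c : ℝ) (S : Set ℝ) : Prop :=
  MeasureTheory.NullMeasurableSet S MeasureTheory.volume ∧
    ∀ a : ℝ, ENNReal.ofReal c ≤ MeasureTheory.volume (S ∩ Set.Icc a (a + 1))

/-- `S` contains a nontrivial affine copy `x A + t`, `x ≠ 0`, of `A`. -/
def ContainsAffineCopy (S A : Set ℝ) : Prop :=
  ∃ x t : ℝ, x ≠ 0 ∧ (fun a : ℝ => x * a + t) '' A ⊆ S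

/-- The length of a real polynomial: the sum of the absolute values of its coefficients. -/
def polyLength (F : ℝ[X]) : ℝ := ∑ i ∈ F.support, |F.coeff i|

/-- Real polynomials whose constant coefficient or leading coefficient is `1`. -/
def GammaSet : Set ℝ[X] := {G | G.coeff 0 = 1 ∨ G.leadingCoeff = 1}

/-- The minimal polynomial over `ℤ` of an algebraic number `b`: the primitive integer multiple of
`minpoly ℚ b` with positive leading coefficient. -/
def intMinpoly (b : ℝ) : ℤ[X] :=
  normalize (IsLocalization.integerNormalization (nonZeroDivisors ℤ) (minpoly ℚ b)).primPart

/-- For algebraic `b`, `intMinpoly b` has the defining properties of the minimal polynomial of `b`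
in `ℤ[X]`: it is irreducible in `ℤ[X]` (in particular primitive), has positive leading coefficient,
and vanishes at `b`. -/
theorem intMinpoly_spec {b : ℝ} (hb : IsAlgebraic ℚ b) :
    Irreducible (intMinpoly b) ∧ 0 < (intMinpoly b).leadingCoeff ∧ aeval b (intMinpoly b) = 0 := by
  set m := minpoly ℚ b with hm
  set q := IsLocalization.integerNormalization (nonZeroDivisors ℤ) m with hq
  have hint : IsIntegral ℚ b := hb.isIntegral
  have hm0 : m ≠ 0 := minpoly.ne_zero hint
  have hq0 : q ≠ 0 := fun h =>
    hm0 ((IsLocalization.integerNormalization_eq_zero_iff le_rfl m).1 h)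
  have hroot : aeval b q.primPart = 0 :=
    aeval_primPart_eq_zero hq0
      (IsLocalization.integerNormalization_aeval_eq_zero _ m (minpoly.aeval ℚ b))
  have hirr : Irreducible q.primPart := by
    rw [q.isPrimitive_primPart.irreducible_iff_irreducible_map_fraction_map (K := ℚ)]
    obtain ⟨c, hc, hcq⟩ := IsLocalization.integerNormalization_spec (nonZeroDivisors ℤ) m
    have hc0 : (c : ℚ) ≠ 0 := by exact_mod_cast nonZeroDivisors.ne_zero hc
    have hk0 : (q.content : ℚ) ≠ 0 := by
      exact_mod_cast fun h => hq0 (content_eq_zero_iff.1 h)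
    have h1 : C (q.content : ℚ) * q.primPart.map (algebraMap ℤ ℚ) = C (c : ℚ) * m := by
      have h2 : (C q.content * q.primPart).map (algebraMap ℤ ℚ) = c • m := by
        rw [← q.eq_C_content_mul_primPart]; exact hcq
      rw [Polynomial.map_mul, map_C] at h2
      rw [← smul_eq_C_mul (c : ℚ), Int.cast_smul_eq_zsmul]
      exact h2
    have h3 : Irreducible (C (c : ℚ) * m) :=
      (irreducible_isUnit_mul (isUnit_C.2 hc0.isUnit)).2 (minpoly.irreducible hint)
    rw [← h1] at h3
    exact (irreducible_isUnit_mul (isUnit_C.2 hk0.isUnit)).1 h3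
  have hass : Associated q.primPart (intMinpoly b) := (normalize_associated q.primPart).symm
  refine ⟨hass.irreducible hirr, ?_, ?_⟩
  · have h : (intMinpoly b).leadingCoeff = normalize q.primPart.leadingCoeff :=
      leadingCoeff_normalize _
    rw [h, ← Int.abs_eq_normalize]
    exact abs_pos.2 (leadingCoeff_ne_zero.2 hirr.ne_zero)
  · obtain ⟨u, hu⟩ := hass
    rw [← hu, map_mul, hroot, zero_mul]

/-- The reduced length `ℓ(b) = inf_{G ∈ Γ} L(P G)`, `P` the minimal polynomial of `b` in `ℤ[X]`. -/
def reducedLength (b : ℝ) : ℝ :=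
  sInf ((fun G : ℝ[X] => polyLength ((intMinpoly b).map (Int.castRingHom ℝ) * G)) '' GammaSet)

end

/-! Choose `δ` with `1 - ε < δ < 1 / ℓ(b)` and `G ∈ Γ` with `L(PG) δ < 1`. The set `S` is `{fract <
δ}` minus a sparse set `E`. Suppose all `x b ^ n + t` have fractional part `s n < δ`, and let `m n`
be their floors. The shift polynomial `P` kills `x b ^ n`, so `u = P(shift) m` is a bounded integer
sequence, and `G(shift) u` is a constant minus `(PG)(shift) s`, hence oscillates by less than `1`.
As an extreme coefficient of `G` is `1`, a window of `u` determines the letter after or before it.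
This leaves countably many `u`, then countably many `m`, and `m` determines `x` because `b > 1`
(`countable_setOf_fract_geom_lt`). The countably many bad `x` are eliminated by `E`, which meets
every translate of each `x b ^ n` yet takes at most `δ - (1 - ε)` from a unit interval
(`exists_sparse_set_meeting_geom`). -/

open Filter Topology MeasureTheory

/-! ### Sequences over a finite alphabet determined by a sliding window -/

/-- Over a finite alphabet there are only countably many sequences in which every window of length
`D` determines the next letter. -/
theorem countable_setOf_window_determines_next (B : Type*) [Finite B] (D : ℕ) :
    {u : ℕ → B | ∀ n n', (∀ j < D, u (n + j) = u (n' + j)) → u (n + D) = u (n' + D)}.Countable := by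
  rcases isEmpty_or_nonempty B with hB | hB
  · have : IsEmpty (ℕ → B) := ⟨fun u => hB.elim (u 0)⟩
    exact Set.to_countable _
  obtain ⟨b₀⟩ := hB
  refine Set.Countable.mono (s₂ := ⋃ f : (Fin D → B) → B, ⋃ w : Fin D → B,
    {u : ℕ → B | (∀ n, u (n + D) = f fun j => u (n + j)) ∧ (fun j : Fin D => u j) = w}) ?_ ?_
  · intro u hu
    have hfac : (fun n => u (n + D)).FactorsThrough (fun n (j : Fin D) => u (n + j)) := by
      intro n n' h
      exact hu n n' fun j hj => congrFun h ⟨j, hj⟩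
    simp only [Set.mem_iUnion]
    refine ⟨Function.extend (fun n (j : Fin D) => u (n + j)) (fun n => u (n + D)) fun _ => b₀,
      fun j => u j, fun n => ?_, rfl⟩
    exact (hfac.extend_apply (fun _ => b₀) n).symm
  · refine Set.countable_iUnion fun f => Set.countable_iUnion fun w => ?_
    refine Set.Subsingleton.countable fun u hu v hv => ?_
    funext n
    induction n using Nat.strong_induction_on with
    | _ n ih =>
      rcases lt_or_ge n D with h | h
      · exact congrFun (hu.2.trans hv.2.symm) ⟨n, h⟩
      · obtain ⟨k, rfl⟩ := Nat.exists_eq_add_of_le' h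
        rw [hu.1, hv.1]
        congr 1
        funext j
        exact ih _ (by have := j.2; omega)

/-- If a fixed rule reads off each letter from the window of length `D` following it, then only
finitely many sequences obey the rule. -/
theorem finite_setOf_window_rule_previous {B : Type*} [Finite B] (D : ℕ) (f : (Fin D → B) → B) :
    {u : ℕ → B | ∀ n, u n = f fun j => u (n + 1 + j)}.Finite := by
  classical
  have hagree : ∀ u v : ℕ → B, (∀ n, u n = f fun j => u (n + 1 + j)) →
      (∀ n, v n = f fun j => v (n + 1 + j)) → ∀ N, (∀ j < D, u (N + j) = v (N + j)) →
      ∀ k ≤ N, ∀ j < D, u (k + j) = v (k + j) := by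
    intro u v hu hv N hN k hk
    induction hk using Nat.decreasingInduction with
    | self => exact hN
    | of_succ k _ ih =>
      intro j hj
      rcases j with _ | j
      · rw [add_zero, hu, hv]
        congr 1
        funext j
        exact ih j j.2
      · have := ih j (by omega)
        rwa [show k + 1 + j = k + (j + 1) by ring] at this
  -- There is no initial window to start from here, but equal windows arbitrarily far out would
  -- force equality before them. Distinct solutions thus have distinct windows from some point on,
  -- and pigeonhole bounds their number.
  have hsep : ∀ u v : ℕ → B, (∀ n, u n = f fun j => u (n + 1 + j)) →
      (∀ n, v n = f fun j => v (n + 1 + j)) → u ≠ v →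
      ∀ᶠ N in atTop, (fun j : Fin D => u (N + j)) ≠ fun j : Fin D => v (N + j) := by
    intro u v hu hv huv
    obtain ⟨k, hk⟩ := Function.ne_iff.1 huv
    filter_upwards [eventually_ge_atTop (k + 1)] with N hN h
    refine hk ?_
    rw [hu, hv]
    congr 1
    funext j
    exact hagree u v hu hv N (fun j hj => congrFun h ⟨j, hj⟩) (k + 1) hN j j.2
  have := Fintype.ofFinite (Fin D → B)
  by_contra hinf
  obtain ⟨F, hF, hcard⟩ := Set.Infinite.exists_subset_card_eq hinf (Fintype.card (Fin D → B) + 1)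
  have hev : ∀ᶠ N in atTop, ∀ u ∈ F, ∀ v ∈ F, u ≠ v →
      (fun j : Fin D => u (N + j)) ≠ fun j : Fin D => v (N + j) := by
    refine (Filter.eventually_all_finset F).2 fun u hu => (Filter.eventually_all_finset F).2
      fun v hv => ?_
    by_cases huv : u = v
    · exact Eventually.of_forall fun _ h => absurd huv h
    · filter_upwards [hsep u v (hF hu) (hF hv) huv] with N hN _ using hN
  obtain ⟨N, hN⟩ := hev.exists
  have hle : F.card ≤ (Finset.univ : Finset (Fin D → B)).card := by
    refine Finset.card_le_card_of_injOn (fun u (j : Fin D) => u (N + j)) (by simp) ?_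
    intro u hu v hv h
    by_contra huv
    exact hN u hu v hv huv h
  rw [hcard, Finset.card_univ] at hle
  omega

/-- Over a finite alphabet there are only countably many sequences in which every window of length
`D` determines the letter before it. -/
theorem countable_setOf_window_determines_previous (B : Type*) [Finite B] (D : ℕ) :
    {u : ℕ → B | ∀ n n', (∀ j < D, u (n + 1 + j) = u (n' + 1 + j)) → u n = u n'}.Countable := by
  rcases isEmpty_or_nonempty B with hB | hB
  · have : IsEmpty (ℕ → B) := ⟨fun u => hB.elim (u 0)⟩
    exact Set.to_countable _
  obtain ⟨b₀⟩ := hB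
  refine Set.Countable.mono (s₂ := ⋃ f : (Fin D → B) → B,
    {u : ℕ → B | ∀ n, u n = f fun j => u (n + 1 + j)}) ?_
    (Set.countable_iUnion fun f => (finite_setOf_window_rule_previous D f).countable)
  intro u hu
  have hfac : u.FactorsThrough (fun n (j : Fin D) => u (n + 1 + j)) := by
    intro n n' h
    exact hu n n' fun j hj => congrFun h ⟨j, hj⟩
  simp only [Set.mem_iUnion]
  exact ⟨Function.extend (fun n (j : Fin D) => u (n + 1 + j)) u fun _ => b₀,
    fun n => (hfac.extend_apply (fun _ => b₀) n).symm⟩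

/-! ### Polynomials acting on sequences through the shift -/

/-- The shift operator on real sequences. -/
def seqShift : Module.End ℝ (ℕ → ℝ) where
  toFun a n := a (n + 1)
  map_add' _ _ := rfl
  map_smul' _ _ := rfl

theorem seqShift_pow_apply (i : ℕ) (a : ℕ → ℝ) (n : ℕ) : (seqShift ^ i) a n = a (n + i) := by
  induction i generalizing n with
  | zero => rfl
  | succ i ih =>
    rw [pow_succ', Module.End.mul_apply]
    change (seqShift ^ i) a (n + 1) = _
    rw [ih, add_assoc, add_comm 1]

theorem aeval_seqShift_apply (F : ℝ[X]) (a : ℕ → ℝ) (n : ℕ) :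
    aeval seqShift F a n = ∑ i ∈ Finset.range (F.natDegree + 1), F.coeff i * a (n + i) := by
  rw [aeval_eq_sum_range]
  simp [LinearMap.sum_apply, seqShift_pow_apply]

theorem aeval_seqShift_const (F : ℝ[X]) (t : ℝ) (n : ℕ) :
    aeval seqShift F (fun _ => t) n = F.eval 1 * t := by
  rw [aeval_seqShift_apply, eval_eq_sum_range, Finset.sum_mul]
  simp

theorem aeval_seqShift_geom (F : ℝ[X]) (x b : ℝ) (n : ℕ) :
    aeval seqShift F (fun k => x * b ^ k) n = F.eval b * (x * b ^ n) := by
  rw [aeval_seqShift_apply, eval_eq_sum_range, Finset.sum_mul]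
  refine Finset.sum_congr rfl fun i _ => ?_
  ring

theorem polyLength_eq_sum_range (F : ℝ[X]) :
    polyLength F = ∑ i ∈ Finset.range (F.natDegree + 1), |F.coeff i| := by
  refine Finset.sum_subset supp_subset_range_natDegree_succ fun i _ hi => ?_
  rw [notMem_support_iff.1 hi, abs_zero]

theorem abs_coeff_le_polyLength (F : ℝ[X]) (i : ℕ) : |F.coeff i| ≤ polyLength F := by
  by_cases hi : i ∈ F.support
  · exact Finset.single_le_sum (f := fun i => |F.coeff i|) (fun _ _ => abs_nonneg _) hi
  · rw [notMem_support_iff.1 hi, abs_zero]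
    exact Finset.sum_nonneg fun _ _ => abs_nonneg _

theorem abs_aeval_seqShift_le (F : ℝ[X]) (a : ℕ → ℝ) (c : ℝ) (n : ℕ)
    (h : ∀ i, |a (n + i)| ≤ c) : |aeval seqShift F a n| ≤ polyLength F * c := by
  rw [aeval_seqShift_apply, polyLength_eq_sum_range, Finset.sum_mul]
  refine (Finset.abs_sum_le_sum_abs _ _).trans (Finset.sum_le_sum fun i _ => ?_)
  rw [abs_mul]
  exact mul_le_mul_of_nonneg_left (h i) (abs_nonneg _)

/-- Differencing termwise costs only the oscillation of `a`. Applying `abs_aeval_seqShift_le` twice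
would lose a factor `2` and spoil the threshold `1 / ℓ(b)`. -/
theorem abs_aeval_seqShift_sub_le (F : ℝ[X]) (a : ℕ → ℝ) (c : ℝ) (n n' : ℕ)
    (h : ∀ i j, |a i - a j| ≤ c) :
    |aeval seqShift F a n - aeval seqShift F a n'| ≤ polyLength F * c := by
  rw [aeval_seqShift_apply, aeval_seqShift_apply, polyLength_eq_sum_range, Finset.sum_mul,
    ← Finset.sum_sub_distrib]
  refine (Finset.abs_sum_le_sum_abs _ _).trans (Finset.sum_le_sum fun i _ => ?_)
  rw [← mul_sub, abs_mul]
  exact mul_le_mul_of_nonneg_left (h _ _) (abs_nonneg _)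

/-! ### Countability -/

/-- Bounded integer sequences `u` such that the values of `G(shift) u` differ by less than `1`, for
a fixed `G` with constant or leading coefficient `1`, form a countable set. -/
theorem countable_setOf_aeval_seqShift_oscillation_lt_one {G : ℝ[X]} (hG : G ∈ GammaSet) :
    {u : ℕ → ℤ | (∃ M : ℕ, ∀ n, |u n| ≤ M) ∧ ∀ n n',
      |aeval seqShift G (fun k => (u k : ℝ)) n -
        aeval seqShift G (fun k => (u k : ℝ)) n'| < 1}.Countable := by
  obtain ⟨D, hD⟩ : ∃ D, G.natDegree = D := ⟨_, rfl⟩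
  have hbwd := fun M : ℕ =>
    countable_setOf_window_determines_previous (Set.Icc (-(M : ℤ)) M) D
  have hfwd := fun M : ℕ =>
    countable_setOf_window_determines_next (Set.Icc (-(M : ℤ)) M) D
  refine Set.Countable.mono ?_ (Set.countable_iUnion fun M : ℕ =>
    ((hbwd M).union (hfwd M)).image fun v n => (v n : ℤ))
  rintro u ⟨⟨M, hM⟩, hu⟩
  refine Set.mem_iUnion.2 ⟨M, fun n => ⟨u n, abs_le.1 (hM n)⟩, ?_, rfl⟩
  have hint : ∀ p q : ℤ, |(p : ℝ) - q| < 1 → p = q := by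
    intro p q h
    have : |p - q| < 1 := by exact_mod_cast h
    exact sub_eq_zero.1 (Int.abs_lt_one_iff.1 this)
  rcases hG with hG | hG
  · refine Or.inl fun n n' h => Subtype.ext (hint _ _ ?_)
    have key := hu n n'
    rw [aeval_seqShift_apply, aeval_seqShift_apply, Finset.sum_range_succ', Finset.sum_range_succ',
      hG, hD] at key
    -- Equal windows cancel every term but the one with coefficient `1`, leaving two integers less
    -- than `1` apart.
    have heq : ∑ i ∈ Finset.range D, G.coeff (i + 1) * (u (n + (i + 1)) : ℝ) =
        ∑ i ∈ Finset.range D, G.coeff (i + 1) * (u (n' + (i + 1)) : ℝ) := by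
      refine Finset.sum_congr rfl fun i hi => ?_
      have := congrArg Subtype.val (h i (Finset.mem_range.1 hi))
      simp only at this
      rw [show n + (i + 1) = n + 1 + i by ring, show n' + (i + 1) = n' + 1 + i by ring, this]
    rw [heq] at key
    simpa using key
  · refine Or.inr fun n n' h => Subtype.ext (hint _ _ ?_)
    have key := hu n n'
    rw [aeval_seqShift_apply, aeval_seqShift_apply, Finset.sum_range_succ, Finset.sum_range_succ,
      coeff_natDegree, hG, hD] at key
    have heq : ∑ i ∈ Finset.range D, G.coeff i * (u (n + i) : ℝ) =
        ∑ i ∈ Finset.range D, G.coeff i * (u (n' + i) : ℝ) := by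
      refine Finset.sum_congr rfl fun i hi => ?_
      have := congrArg Subtype.val (h i (Finset.mem_range.1 hi))
      simp only at this
      rw [this]
    rw [heq] at key
    simpa using key

/-- An inhomogeneous linear recurrence over `ℤ` has only countably many solutions. -/
theorem countable_setOf_linear_recurrence {P : ℤ[X]} (hP : P ≠ 0) (u : ℕ → ℤ) :
    {m : ℕ → ℤ | ∀ n, ∑ i ∈ Finset.range (P.natDegree + 1), P.coeff i * m (n + i) =
      u n}.Countable := by
  have hmaps : Set.InjOn (fun (m : ℕ → ℤ) (j : Fin P.natDegree) => m j)
      {m | ∀ n, ∑ i ∈ Finset.range (P.natDegree + 1), P.coeff i * m (n + i) = u n} := by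
    intro m hm m' hm' h
    funext n
    induction n using Nat.strong_induction_on with
    | _ n ih =>
      rcases lt_or_ge n P.natDegree with hn | hn
      · exact congrFun h ⟨n, hn⟩
      · obtain ⟨k, rfl⟩ := Nat.exists_eq_add_of_le' hn
        have e := (hm k).trans (hm' k).symm
        rw [Finset.sum_range_succ, Finset.sum_range_succ] at e
        have heq : ∑ i ∈ Finset.range P.natDegree, P.coeff i * m (k + i) =
            ∑ i ∈ Finset.range P.natDegree, P.coeff i * m' (k + i) := by
          refine Finset.sum_congr rfl fun i hi => ?_
          rw [ih _ (by have := Finset.mem_range.1 hi; omega)]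
        rw [heq, add_right_inj, coeff_natDegree] at e
        exact mul_left_cancel₀ (leadingCoeff_ne_zero.2 hP) e
  exact (Set.mapsTo_univ _ _).countable_of_injOn hmaps Set.countable_univ

/-- If `δ < 1 / L(PG)` for some `G ∈ Γ`, where `P ∈ ℤ[X]` vanishes at `b > 1`, then only countably
many dilates of `b ^ n` have a translate whose fractional parts all lie in `[0, δ)`. -/
theorem countable_setOf_fract_geom_lt {b : ℝ} (hb : 1 < b) {P : ℤ[X]} (hP : P ≠ 0)
    (hroot : aeval b P = 0) {G : ℝ[X]} (hG : G ∈ GammaSet) {δ : ℝ}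
    (hδ : polyLength (P.map (Int.castRingHom ℝ) * G) * δ < 1) :
    {x : ℝ | ∃ t : ℝ, ∀ n : ℕ, Int.fract (x * b ^ n + t) < δ}.Countable := by
  set Q := P.map (Int.castRingHom ℝ) with hQ
  have hQroot : Q.eval b = 0 := by
    rw [hQ, eval_map, ← hroot]
    rfl
  have hQdeg : Q.natDegree = P.natDegree :=
    natDegree_map_eq_of_injective (Int.castRingHom ℝ).injective_int P
  set U := {u : ℕ → ℤ | (∃ M : ℕ, ∀ n, |u n| ≤ M) ∧ ∀ n n',
    |aeval seqShift G (fun k => (u k : ℝ)) n - aeval seqShift G (fun k => (u k : ℝ)) n'| < 1}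
  have hU : U.Countable := countable_setOf_aeval_seqShift_oscillation_lt_one hG
  have hV := hU.biUnion fun u _ => countable_setOf_linear_recurrence hP u
  refine Set.Countable.mono ?_ (hV.biUnion (t := fun m _ =>
    {x : ℝ | ∃ t : ℝ, ∀ n : ℕ, ⌊x * b ^ n + t⌋ = m n}) fun m _ => ?_)
  · rintro x ⟨t, ht⟩
    set m : ℕ → ℤ := fun n => ⌊x * b ^ n + t⌋ with hm
    set s : ℕ → ℝ := fun n => Int.fract (x * b ^ n + t) with hs
    set u : ℕ → ℤ := fun n => ∑ i ∈ Finset.range (P.natDegree + 1), P.coeff i * m (n + i) with hu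
    have hureal : (fun k => (u k : ℝ)) = aeval seqShift Q (fun k => (m k : ℝ)) := by
      funext n
      rw [aeval_seqShift_apply, hQdeg]
      simp [hu, hQ]
    have hmeq : (fun k => (m k : ℝ)) = (fun k => x * b ^ k) + (fun _ => t) - s := by
      funext n
      simp only [Pi.add_apply, Pi.sub_apply, hm, hs]
      linarith [Int.floor_add_fract (x * b ^ n + t)]
    -- The translation contributes `F.eval 1 * t`, independent of `n`, so it drops out of
    -- differences.
    have hact : ∀ F : ℝ[X], F.eval b = 0 → ∀ n, aeval seqShift F (fun k => (m k : ℝ)) n =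
        F.eval 1 * t - aeval seqShift F s n := by
      intro F hF n
      rw [hmeq, map_sub, map_add, Pi.sub_apply, Pi.add_apply, aeval_seqShift_geom,
        aeval_seqShift_const, hF]
      ring
    have hs0 : ∀ n, 0 ≤ s n := fun n => Int.fract_nonneg _
    have hs1 : ∀ n, s n < δ := ht
    refine Set.mem_biUnion (x := m) (Set.mem_biUnion (x := u) ⟨?_, fun n n' => ?_⟩ fun n => rfl)
      ⟨t, fun n => rfl⟩
    · obtain ⟨M, hM⟩ := exists_nat_ge (|Q.eval 1 * t| + polyLength Q * δ)
      refine ⟨M, fun n => ?_⟩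
      have h1 : |(u n : ℝ)| ≤ M := by
        rw [show (u n : ℝ) = _ from congrFun hureal n, hact Q hQroot]
        refine (abs_sub _ _).trans (le_trans ?_ hM)
        gcongr
        refine abs_aeval_seqShift_le Q s δ n fun i => ?_
        rw [abs_of_nonneg (hs0 _)]
        exact (hs1 _).le
      exact_mod_cast h1
    · have hmul : aeval seqShift G (aeval seqShift Q (fun k => (m k : ℝ))) =
          aeval seqShift (Q * G) (fun k => (m k : ℝ)) := by
        rw [mul_comm, map_mul, Module.End.mul_apply]
      have hQG : (Q * G).eval b = 0 := by rw [eval_mul, hQroot, zero_mul]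
      rw [hureal, hmul, hact _ hQG, hact _ hQG, sub_sub_sub_cancel_left]
      refine lt_of_le_of_lt (abs_aeval_seqShift_sub_le (Q * G) s δ n' n fun i j => ?_) hδ
      rw [abs_le]
      constructor <;> linarith [hs0 i, hs0 j, hs1 i, hs1 j]
  · refine Set.Subsingleton.countable ?_
    -- Equal floors keep the two progressions within `1`, whereas `(x - x') * b ^ n` is unbounded
    -- unless `x = x'`.
    rintro x ⟨t, ht⟩ x' ⟨t', ht'⟩
    by_contra hne
    have hpos : 0 < |x - x'| := abs_pos.2 (sub_ne_zero.2 hne)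
    obtain ⟨n, hn⟩ := pow_unbounded_of_one_lt ((1 + |t - t'|) / |x - x'|) hb
    rw [div_lt_iff₀ hpos] at hn
    have h1 : |(x * b ^ n + t) - (x' * b ^ n + t')| < 1 :=
      Int.abs_sub_lt_one_of_floor_eq_floor ((ht n).trans (ht' n).symm)
    have h2 : |(x - x') * b ^ n| ≤ |(x * b ^ n + t) - (x' * b ^ n + t')| + |t - t'| := by
      rw [show (x - x') * b ^ n = ((x * b ^ n + t) - (x' * b ^ n + t')) - (t - t') by ring]
      exact abs_sub _ _
    rw [abs_mul, abs_of_pos (pow_pos (zero_lt_one.trans hb) n)] at h2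
    linarith

/-! ### Sparse sets meeting all translates of countably many dilates -/

/-- For a countable set `X` of nonzero ratios there is a measurable set of measure at most `κ` in
every unit interval, which meets every translate of every `x b ^ n`, `x ∈ X`. -/
theorem exists_sparse_set_meeting_geom {b : ℝ} (hb : 1 < b) {X : Set ℝ} (hX : X.Countable)
    (h0 : ∀ x ∈ X, x ≠ 0) {κ : ℝ} (hκ : 0 < κ) (hκ1 : κ ≤ 1) :
    ∃ E : Set ℝ, MeasurableSet E ∧
      (∀ a, volume (E ∩ Set.Icc a (a + 1)) ≤ ENNReal.ofReal κ) ∧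
      ∀ x ∈ X, ∀ t : ℝ, ∃ n : ℕ, x * b ^ n + t ∈ E := by
  rcases X.eq_empty_or_nonempty with rfl | hne
  · exact ⟨∅, MeasurableSet.empty, by simp, by simp⟩
  -- Translations are discretised to the grid `κ ℤ`; an interval of length `κ` absorbs the rounding
  -- error.
  obtain ⟨τ, hτ⟩ := (hX.prod (Set.countable_univ (α := ℤ))).exists_eq_range
    (hne.prod Set.univ_nonempty)
  have hτ0 : ∀ k, (τ k).1 ≠ 0 := fun k =>
    h0 _ (hτ.symm ▸ Set.mem_range_self k : τ k ∈ X ×ˢ (Set.univ : Set ℤ)).1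
  have hfar : ∀ k (R : ℝ), ∃ n : ℕ, R + 3 ≤ |(τ k).1 * b ^ n + (τ k).2 * κ| := by
    intro k R
    have hpos : 0 < |(τ k).1| := abs_pos.2 (hτ0 k)
    obtain ⟨n, hn⟩ := pow_unbounded_of_one_lt ((R + 3 + |(τ k).2 * κ|) / |(τ k).1|) hb
    rw [div_lt_iff₀ hpos] at hn
    refine ⟨n, ?_⟩
    have h2 : |(τ k).1 * b ^ n| ≤ |(τ k).1 * b ^ n + (τ k).2 * κ| + |(τ k).2 * κ| := by
      simpa using abs_sub ((τ k).1 * b ^ n + (τ k).2 * κ) ((τ k).2 * κ)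
    rw [abs_mul, abs_of_pos (pow_pos (zero_lt_one.trans hb) n)] at h2
    linarith
  choose ν hν using hfar
  -- Gaps of at least `3` exceed `1 + κ`, so a unit interval meets at most one of the intervals `[c
  -- k, c k + κ]`.
  let c : ℕ → ℝ := fun k => Nat.rec ((τ 0).1 * b ^ ν 0 0 + (τ 0).2 * κ)
    (fun k r => (τ (k + 1)).1 * b ^ ν (k + 1) |r| + (τ (k + 1)).2 * κ) k
  have hcform : ∀ k, ∃ n : ℕ, c k = (τ k).1 * b ^ n + (τ k).2 * κ := by
    rintro (_ | k)
    · exact ⟨_, rfl⟩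
    · exact ⟨_, rfl⟩
  have hcstep : ∀ k, |c k| + 3 ≤ |c (k + 1)| := fun k => hν (k + 1) |c k|
  have hclt : ∀ k l, k < l → |c k| + 3 ≤ |c l| := by
    intro k l hkl
    induction l, hkl using Nat.le_induction with
    | base => exact hcstep k
    | succ l _ ih => linarith [hcstep l]
  have hcsep : ∀ k l, |c k - c l| < 3 → k = l := by
    intro k l h
    by_contra hne
    rcases lt_or_gt_of_ne hne with hkl | hkl
    · have := abs_sub_abs_le_abs_sub (c l) (c k)
      rw [abs_sub_comm] at this
      linarith [hclt k l hkl]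
    · linarith [abs_sub_abs_le_abs_sub (c k) (c l), hclt l k hkl]
  refine ⟨⋃ k, Set.Icc (c k) (c k + κ), MeasurableSet.iUnion fun _ => measurableSet_Icc, ?_, ?_⟩
  · intro a
    by_cases hmeet : ∃ k, (Set.Icc (c k) (c k + κ) ∩ Set.Icc a (a + 1)).Nonempty
    · obtain ⟨k, y, ⟨hy1, hy2⟩, hy3, hy4⟩ := hmeet
      calc volume ((⋃ k, Set.Icc (c k) (c k + κ)) ∩ Set.Icc a (a + 1))
          ≤ volume (Set.Icc (c k) (c k + κ)) := by
            refine measure_mono ?_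
            rintro z ⟨hz, hz3, hz4⟩
            obtain ⟨l, hz1, hz2⟩ := Set.mem_iUnion.1 hz
            have : k = l := hcsep k l (by rw [abs_lt]; constructor <;> linarith)
            subst this
            exact ⟨hz1, hz2⟩
        _ = ENNReal.ofReal κ := by rw [Real.volume_Icc, add_sub_cancel_left]
    · have : (⋃ k, Set.Icc (c k) (c k + κ)) ∩ Set.Icc a (a + 1) = ∅ := by
        refine Set.eq_empty_iff_forall_notMem.2 ?_
        rintro z ⟨hz, hz'⟩
        obtain ⟨l, hl⟩ := Set.mem_iUnion.1 hz
        exact hmeet ⟨l, z, hl, hz'⟩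
      rw [this, measure_empty]
      exact zero_le
  · intro x hx t
    have hmem : (x, ⌊t / κ⌋) ∈ Set.range τ := hτ ▸ ⟨hx, Set.mem_univ _⟩
    obtain ⟨k, hk⟩ := hmem
    obtain ⟨n, hn⟩ := hcform k
    rw [hk] at hn
    have h1 : (⌊t / κ⌋ : ℝ) * κ ≤ t := (le_div_iff₀ hκ).1 (Int.floor_le _)
    have h2 : t < (⌊t / κ⌋ + 1 : ℝ) * κ := (div_lt_iff₀ hκ).1 (Int.lt_floor_add_one _)
    refine ⟨n, Set.mem_iUnion.2 ⟨k, ?_⟩⟩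
    simp only at hn
    constructor <;> linarith

/-- The reals with fractional part below `δ` have measure at least `δ` in every unit interval. -/
theorem ofReal_le_volume_fract_lt {δ : ℝ} (hδ1 : δ ≤ 1) (a : ℝ) :
    ENNReal.ofReal δ ≤ volume ({y : ℝ | Int.fract y < δ} ∩ Set.Icc a (a + 1)) := by
  have hmem : ∀ (N : ℤ) (y : ℝ), (N : ℝ) ≤ y → y < N + δ → Int.fract y < δ := by
    intro N y h1 h2
    have : ⌊y⌋ = N := Int.floor_eq_iff.2 ⟨h1, by linarith⟩
    rw [Int.fract, this]
    linarith
  have ha1 := Int.floor_le a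
  have ha2 := Int.lt_floor_add_one a
  -- Either `[a, a + 1]` cuts a block, whose tail and the start of the next block add up to `δ`, or
  -- it contains the whole next block.
  rcases le_or_gt (Int.fract a) δ with h | h
  · rw [Int.fract] at h
    have hsub : Set.Ico a (⌊a⌋ + δ) ∪ Set.Ico (⌊a⌋ + 1 : ℝ) (a + 1) ⊆
        {y : ℝ | Int.fract y < δ} ∩ Set.Icc a (a + 1) := by
      rintro y (⟨h1, h2⟩ | ⟨h1, h2⟩)
      · exact ⟨hmem ⌊a⌋ y (by linarith) h2, h1, by linarith⟩
      · exact ⟨hmem (⌊a⌋ + 1) y (by push_cast; linarith) (by push_cast; linarith),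
          by linarith, h2.le⟩
    refine le_trans (le_of_eq ?_) (measure_mono hsub)
    rw [measure_union _ measurableSet_Ico, Real.volume_Ico, Real.volume_Ico,
      ← ENNReal.ofReal_add (by linarith) (by linarith)]
    · congr 1
      ring
    · refine Set.disjoint_left.2 ?_
      rintro y ⟨_, h2⟩ ⟨h3, _⟩
      linarith
  · rw [Int.fract] at h
    have hsub : Set.Ico (⌊a⌋ + 1 : ℝ) (⌊a⌋ + 1 + δ) ⊆
        {y : ℝ | Int.fract y < δ} ∩ Set.Icc a (a + 1) := by
      rintro y ⟨h1, h2⟩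
      exact ⟨hmem (⌊a⌋ + 1) y (by push_cast; linarith) (by push_cast; linarith),
        by linarith, by linarith⟩
    refine le_trans (le_of_eq ?_) (measure_mono hsub)
    rw [Real.volume_Ico, add_sub_cancel_left]

/-! ### The reduced length -/

/-- An extreme coefficient of `PG` is a nonzero integer coefficient of `P`. -/
theorem one_le_polyLength_mul {P : ℤ[X]} (h0 : P.coeff 0 ≠ 0) {G : ℝ[X]} (hG : G ∈ GammaSet) :
    1 ≤ polyLength (P.map (Int.castRingHom ℝ) * G) := by
  have hint : ∀ k : ℤ, k ≠ 0 → (1 : ℝ) ≤ |(k : ℝ)| := fun k hk => by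
    exact_mod_cast Int.one_le_abs hk
  rcases hG with hG | hG
  · refine le_trans ?_ (abs_coeff_le_polyLength _ 0)
    rw [mul_coeff_zero, hG, mul_one, coeff_map]
    exact hint _ h0
  · refine le_trans ?_ (abs_coeff_le_polyLength _ (P.map (Int.castRingHom ℝ) * G).natDegree)
    rw [coeff_natDegree, leadingCoeff_mul, hG, mul_one,
      leadingCoeff_map_of_injective (Int.castRingHom ℝ).injective_int]
    refine hint _ (leadingCoeff_ne_zero.2 fun h => h0 ?_)
    rw [h, coeff_zero]

theorem intMinpoly_coeff_zero_ne_zero {b : ℝ} (hb : IsAlgebraic ℚ b) (hb1 : 1 < b) :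
    (intMinpoly b).coeff 0 ≠ 0 := by
  obtain ⟨hirr, -, hroot⟩ := intMinpoly_spec hb
  intro h
  obtain ⟨q, hq⟩ := X_dvd_iff.2 h
  have hq' : IsUnit q := (hirr.isUnit_or_isUnit hq).resolve_left not_isUnit_X
  obtain ⟨r, hr, hrq⟩ := isUnit_iff.1 hq'
  rw [hq, map_mul, aeval_X, ← hrq, aeval_C] at hroot
  rcases mul_eq_zero.1 hroot with h1 | h1
  · linarith
  · exact hr.ne_zero (by simpa using h1)

theorem one_le_reducedLength {b : ℝ} (hb : IsAlgebraic ℚ b) (hb1 : 1 < b) :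
    1 ≤ reducedLength b := by
  refine le_csInf (Set.Nonempty.image _ ⟨1, Or.inr leadingCoeff_one⟩) ?_
  rintro _ ⟨G, hG, rfl⟩
  exact one_le_polyLength_mul (intMinpoly_coeff_zero_ne_zero hb hb1) hG

theorem theorem1p5 (b : ℝ) (hb : 1 < b) (hb_alg : IsAlgebraic ℚ b)
    (ε : ℝ) (hε : ε ∈ Set.Ioc (1 - 1 / reducedLength b) 1) :
    ∃ S : Set ℝ, IsLargeSet (1 - ε) S ∧
      ¬ ContainsAffineCopy S (Set.range fun n : ℕ => b ^ n) := by
  have hl1 := one_le_reducedLength hb_alg hb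
  obtain ⟨δ, hεδ, hδl⟩ : ∃ δ, 1 - ε < δ ∧ δ < 1 / reducedLength b :=
    exists_between (by linarith [hε.1])
  have hδ0 : 0 < δ := by linarith [hε.2]
  have hδ1 : δ ≤ 1 := hδl.le.trans ((div_le_one (by linarith)).2 hl1)
  obtain ⟨_, ⟨G, hG, rfl⟩, hGδ⟩ := exists_lt_of_csInf_lt
    (Set.Nonempty.image _ (⟨1, Or.inr leadingCoeff_one⟩ : GammaSet.Nonempty))
    (show reducedLength b < 1 / δ from (lt_one_div hδ0 (by linarith)).1 hδl)
  obtain ⟨hirr, -, hroot⟩ := intMinpoly_spec hb_alg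
  have hcount := countable_setOf_fract_geom_lt hb hirr.ne_zero hroot hG ((lt_div_iff₀ hδ0).1 hGδ)
  -- The ratio `0` is excluded, as its progression never moves; `κ` is the slack `δ - (1 - ε)`.
  obtain ⟨E, hEm, hEvol, hE⟩ := exists_sparse_set_meeting_geom hb
    (hcount.mono (Set.sdiff_subset (t := {0}))) (fun x hx => hx.2)
    (show 0 < δ - (1 - ε) by linarith) (by linarith [hε.2])
  have hAm : MeasurableSet {y : ℝ | Int.fract y < δ} :=
    measurableSet_lt measurable_fract measurable_const
  refine ⟨{y : ℝ | Int.fract y < δ} \ E, ⟨(hAm.diff hEm).nullMeasurableSet, fun a => ?_⟩, ?_⟩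
  · have hsplit : ({y : ℝ | Int.fract y < δ} \ E) ∩ Set.Icc a (a + 1) =
        ({y : ℝ | Int.fract y < δ} ∩ Set.Icc a (a + 1)) \ (E ∩ Set.Icc a (a + 1)) := by
      ext y
      simp only [Set.mem_inter_iff, Set.mem_sdiff]
      tauto
    rw [hsplit]
    calc ENNReal.ofReal (1 - ε) = ENNReal.ofReal δ - ENNReal.ofReal (δ - (1 - ε)) := by
          rw [← ENNReal.ofReal_sub _ (by linarith), sub_sub_cancel]
      _ ≤ volume ({y : ℝ | Int.fract y < δ} ∩ Set.Icc a (a + 1)) -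
          volume (E ∩ Set.Icc a (a + 1)) :=
          tsub_le_tsub (ofReal_le_volume_fract_lt hδ1 a) (hEvol a)
      _ ≤ _ := le_measure_sdiff
  · rintro ⟨x, t, hx, hsub⟩
    have hmem : ∀ n : ℕ, x * b ^ n + t ∈ {y : ℝ | Int.fract y < δ} \ E := fun n =>
      hsub ⟨b ^ n, ⟨n, rfl⟩, rfl⟩
    obtain ⟨n, hn⟩ := hE x ⟨⟨t, fun n => (hmem n).1⟩, hx⟩ t
    exact (hmem n).2 hn
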